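/- Let $n>1$ and let $P,Q\in\mathbb R[x,y]$ be coprime homogeneous polynomials of degree $n$. Consider the planar system $\dot x=P(x,y)$, $\dot y=Q(x,y)$, and put $$G(x,y)=xQ(x,y)-yP(x,y),\qquad H(x,y)=yQ(x,y)+xP(x,y),$$ $$\widetilde G(\theta)=G(\cos\theta,\sin\theta),\qquad \widetilde H(\theta)=H(\cos\theta,\sin\theta).$$ Say that an orbit of the system connects the origin along the direction $\theta=\pi/2$ if, as $t\to+\infty$ or as $t\to-\infty$, its point $(x(t),y(t))$ tends to the origin and the unit vector $(x(t),y(t))/\sqrt{x(t)^2+y(t)^2}$ tends to $(0,1)$; that is, the orbit reaches the origin tangent to the positive $y$-semi-axis. Assume that $\theta=\pi/2$ is a zero of multiplicity $m$ of $\widetilde G$. 1. If $m>0$ is even, then infinitely many orbits connect the origin along the direction $\theta=\pi/2$. 2. If $m$ is odd, then infinitely many orbits connect the origin along the direction $\theta=\pi/2$ if $\widetilde G^{(m)}(\pi/2)\,\widetilde H(\pi/2)>0$, and exactly one orbit does so if $\widetilde G^{(m)}(\pi/2)\,\widetilde H(\pi/2)<0$. -/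

import Mathlib

open Filter Topology

noncomputable section

namespace HomogeneousPlanarSystem

open MvPolynomial

/-- The planar vector field `(P(x,y), Q(x,y))`; variable `0` is `x` and variable `1` is `y`. -/
def field (P Q : MvPolynomial (Fin 2) ℝ) (z : ℝ × ℝ) : ℝ × ℝ :=
  (eval ![z.1, z.2] P, eval ![z.1, z.2] Q)

/-- `γ` solves `x' = P(x,y)`, `y' = Q(x,y)` at every time of `I` (used for open intervals `I`). -/
def IsSolutionOn (P Q : MvPolynomial (Fin 2) ℝ) (γ : ℝ → ℝ × ℝ) (I : Set ℝ) : Prop :=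
  ∀ t ∈ I, HasDerivAt γ (field P Q (γ t)) t

/-- The orbit through `p`: all points that some solution, defined on some open interval,
joins to `p` in forward or backward time. It is the image of the maximal solution through `p`. -/
def orbit (P Q : MvPolynomial (Fin 2) ℝ) (p : ℝ × ℝ) : Set (ℝ × ℝ) :=
  {q | ∃ (γ : ℝ → ℝ × ℝ) (I : Set ℝ), IsOpen I ∧ I.OrdConnected ∧ IsSolutionOn P Q γ I ∧
    ∃ s ∈ I, ∃ t ∈ I, γ s = p ∧ γ t = q}

/-- Along the filter `l`, the point `γ t` tends to the origin and its unit direction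
`γ t / |γ t|` (Euclidean norm) tends to `(cos θ, sin θ)`. -/
def TendsToOriginAlong (γ : ℝ → ℝ × ℝ) (l : Filter ℝ) (θ : ℝ) : Prop :=
  Tendsto γ l (𝓝 0) ∧
  Tendsto (fun t => (γ t).1 / √((γ t).1 ^ 2 + (γ t).2 ^ 2)) l (𝓝 (Real.cos θ)) ∧
  Tendsto (fun t => (γ t).2 / √((γ t).1 ^ 2 + (γ t).2 ^ 2)) l (𝓝 (Real.sin θ))

/-- The set `O` contains a forward (or backward) half-trajectory that tends to the origin, as time
tends to `+∞` (or to `-∞`), along the direction `θ`. -/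
def ConnectsOriginAlong (P Q : MvPolynomial (Fin 2) ℝ) (O : Set (ℝ × ℝ)) (θ : ℝ) : Prop :=
  ∃ γ : ℝ → ℝ × ℝ,
    (IsSolutionOn P Q γ (Set.Ioi 0) ∧ (∀ t ∈ Set.Ioi (0 : ℝ), γ t ∈ O) ∧
      TendsToOriginAlong γ atTop θ) ∨
    (IsSolutionOn P Q γ (Set.Iio 0) ∧ (∀ t ∈ Set.Iio (0 : ℝ), γ t ∈ O) ∧
      TendsToOriginAlong γ atBot θ)

/-- The set of all orbits connecting the origin along the direction `θ`. -/
def orbitsAlong (P Q : MvPolynomial (Fin 2) ℝ) (θ : ℝ) : Set (Set (ℝ × ℝ)) :=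
  {O | (∃ p : ℝ × ℝ, O = orbit P Q p) ∧ ConnectsOriginAlong P Q O θ}

/-- `G(x,y) = x Q(x,y) - y P(x,y)`. -/
def G (P Q : MvPolynomial (Fin 2) ℝ) : MvPolynomial (Fin 2) ℝ := X 0 * Q - X 1 * P

/-- `H(x,y) = y Q(x,y) + x P(x,y)`. -/
def H (P Q : MvPolynomial (Fin 2) ℝ) : MvPolynomial (Fin 2) ℝ := X 1 * Q + X 0 * P

/-- `G(cos θ, sin θ)`. -/
def Gtilde (P Q : MvPolynomial (Fin 2) ℝ) (θ : ℝ) : ℝ :=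
  eval ![Real.cos θ, Real.sin θ] (G P Q)

/-- `H(cos θ, sin θ)`. -/
def Htilde (P Q : MvPolynomial (Fin 2) ℝ) (θ : ℝ) : ℝ :=
  eval ![Real.cos θ, Real.sin θ] (H P Q)

end HomogeneousPlanarSystem

end

/-!
Near the direction `π / 2` the slope `u = x / y` is a coordinate, and for `P`, `Q` homogeneous of
degree `k + 1` the system reads `u' = y ^ k g(u)`, `y' = y ^ (k + 1) h(u)` with
`g(u) = P(u, 1) - u Q(u, 1)` (`slopeRate`) and `h(u) = Q(u, 1)`. The slope `u` belongs to the angle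
`π / 2 - arctan u`, so `g` has at `0` a zero of the same multiplicity as `Gtilde` at `π / 2`, with a
leading coefficient of known sign (`exists_sign_slopeRate`). Moreover `h 0 = Htilde (π / 2)`, which
is nonzero because `P` and `Q` are coprime. Reversing time (`orbitsAlong_neg`) allows one to assume
`h 0 < 0`, that is, the positive `y`-axis is traversed towards the origin.

If `|u|` decreases on one side of the axis, the system is solved there by quadrature,
`y = exp ∫ h / g` (`exists_solution_sector`): as `u → 0`, both `y → 0` and the elapsed time becomes
infinite, so the solution connects the origin. Its dilates are solutions up to a change of the unit
of time, and uniqueness for the initial value problem puts them on distinct orbits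
(`orbit_smul_ne`, `infinite_orbitsAlong_of_sector`). This covers every positive even multiplicity,
where one of the two sides is of this kind, and odd multiplicity with positive product.

If `|u|` increases on both sides, then along an orbit connecting the origin in forward time `u ^ 2`
is eventually nondecreasing with limit `0`, hence zero (`exists_mem_axis_of_tendsto`); backward time
is impossible since `y` decreases (`not_tendsToOriginAlong_atBot`). So the orbit is the positive
`y`-axis, which does connect the origin (`existsUnique_orbitsAlong`).
-/

/-! ### Homogeneous polynomials in two variables -/

namespace HomogeneousPlanarSystem

open MvPolynomial

theorem eval_smul_of_isHomogeneous {p : MvPolynomial (Fin 2) ℝ} {n : ℕ} (hp : p.IsHomogeneous n)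
    (c x y : ℝ) : eval ![c * x, c * y] p = c ^ n * eval ![x, y] p := by
  rw [eval_eq', eval_eq', Finset.mul_sum]
  refine Finset.sum_congr rfl fun d hd => ?_
  have hdeg : d 0 + d 1 = n := by
    have := hp (mem_support_iff.mp hd)
    simpa [Finsupp.weight_apply, Finsupp.sum_fintype] using this
  simp only [Fin.prod_univ_two, Matrix.cons_val_zero, Matrix.cons_val_one, mul_pow]
  rw [← hdeg, pow_add]
  ring

theorem X_zero_dvd_of_eval_eq_zero {p : MvPolynomial (Fin 2) ℝ} {n : ℕ} (hp : p.IsHomogeneous n)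
    (h : eval ![0, 1] p = 0) : X 0 ∣ p := by
  have hdeg : ∀ d ∈ p.support, d 0 + d 1 = n := fun d hd => by
    have := hp (mem_support_iff.mp hd)
    simpa [Finsupp.weight_apply, Finsupp.sum_fintype] using this
  have hpure : ∀ d ∈ p.support, d 0 = 0 → d = Finsupp.single 1 n := by
    intro d hd h0
    have := hdeg d hd
    ext i
    fin_cases i <;> simp_all
  have hcoeff : coeff (Finsupp.single 1 n) p = 0 := by
    rw [eval_eq', Finset.sum_eq_single (Finsupp.single 1 n)] at h
    · simpa [Fin.prod_univ_two] using h
    · intro d hd hne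
      have : d 0 ≠ 0 := fun h0 => hne (hpure d hd h0)
      simp [Fin.prod_univ_two, this]
    · intro hd
      simp [notMem_support_iff.mp hd]
  rw [X_dvd_iff_modMonomial_eq_zero]
  ext d
  by_cases hd : Finsupp.single 0 1 ≤ d
  · simp [coeff_modMonomial_of_le _ hd]
  rw [coeff_modMonomial_of_not_le _ hd, coeff_zero]
  by_contra hne
  have h0 : d 0 = 0 := by
    by_contra h0
    exact hd (Finsupp.single_le_iff.mpr (Nat.one_le_iff_ne_zero.mpr h0))
  rw [hpure d (mem_support_iff.mpr hne) h0] at hne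
  exact hne hcoeff

/-- Coprime homogeneous polynomials have no common zero on the line `x = 0`: otherwise `x` would
divide both. -/
theorem eval_ne_zero_of_isRelPrime {P Q : MvPolynomial (Fin 2) ℝ} {n : ℕ}
    (hP : P.IsHomogeneous n) (hQ : Q.IsHomogeneous n) (hPQ : IsRelPrime P Q)
    (h : eval ![0, 1] P = 0) : eval ![0, 1] Q ≠ 0 := fun h' => by
  have hu := hPQ (X_zero_dvd_of_eval_eq_zero hP h) (X_zero_dvd_of_eval_eq_zero hQ h')
  have := hu.map (eval ![(0 : ℝ), 1])
  simp at this

theorem analyticAt_eval_comp (p : MvPolynomial (Fin 2) ℝ) {a b : ℝ → ℝ} {t : ℝ}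
    (ha : AnalyticAt ℝ a t) (hb : AnalyticAt ℝ b t) :
    AnalyticAt ℝ (fun s => eval ![a s, b s] p) t := by
  have := AnalyticAt.aeval_mvPolynomial (f := fun s => ![a s, b s]) (z := t) (A := ℝ)
    (by intro i; fin_cases i <;> simpa) p
  simpa [MvPolynomial.aeval_eq_eval] using this

theorem continuous_eval_left (p : MvPolynomial (Fin 2) ℝ) :
    Continuous fun u : ℝ => eval ![u, 1] p :=
  continuous_iff_continuousAt.mpr fun _ =>
    (analyticAt_eval_comp p analyticAt_id analyticAt_const).continuousAt

theorem contDiff_field (P Q : MvPolynomial (Fin 2) ℝ) : ContDiff ℝ 1 (field P Q) := by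
  have key : ∀ p : MvPolynomial (Fin 2) ℝ, ContDiff ℝ 1 fun z : ℝ × ℝ => eval ![z.1, z.2] p := by
    intro p
    simp_rw [eval_eq', Fin.prod_univ_two]
    simp only [Matrix.cons_val_zero, Matrix.cons_val_one, Matrix.cons_val_fin_one]
    exact ContDiff.sum fun d _ => by fun_prop
  exact (key P).prodMk (key Q)

/-! ### Solutions and orbits -/

variable {P Q : MvPolynomial (Fin 2) ℝ} {γ γ₁ γ₂ : ℝ → ℝ × ℝ} {I J : Set ℝ}

theorem IsSolutionOn.mono (h : IsSolutionOn P Q γ I) (hJ : J ⊆ I) : IsSolutionOn P Q γ J :=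
  fun t ht => h t (hJ ht)

theorem IsSolutionOn.comp_add_const (h : IsSolutionOn P Q γ I) (c : ℝ) :
    IsSolutionOn P Q (fun t => γ (t + c)) ((· + c) ⁻¹' I) :=
  fun t ht => (h (t + c) ht).comp_add_const t c

theorem IsSolutionOn.comp_neg (h : IsSolutionOn P Q γ I) :
    IsSolutionOn (-P) (-Q) (fun t => γ (-t)) ((fun t => -t) ⁻¹' I) := by
  intro t ht
  have := (h (-t) ht).scomp t (hasDerivAt_neg t)
  simpa [field, Function.comp_def] using this

/-- Homogeneity of degree `k + 1`: the dilated curve `c γ(c ^ k t)` is again a solution. -/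
theorem IsSolutionOn.dilate {k : ℕ} (hP : P.IsHomogeneous (k + 1)) (hQ : Q.IsHomogeneous (k + 1))
    (h : IsSolutionOn P Q γ I) (c : ℝ) :
    IsSolutionOn P Q (fun t => c • γ (c ^ k * t)) ((fun t => c ^ k * t) ⁻¹' I) := by
  intro t ht
  have h1 : HasDerivAt (fun t : ℝ => c ^ k * t) (c ^ k) t := by
    simpa using (hasDerivAt_id t).const_mul (c ^ k)
  have := ((h (c ^ k * t) ht).scomp t h1).const_smul c
  convert! this using 1
  simp only [field, Prod.smul_fst, Prod.smul_snd, smul_eq_mul, eval_smul_of_isHomogeneous hP,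
    eval_smul_of_isHomogeneous hQ, Prod.smul_mk, pow_succ]
  ext <;> simp <;> ring

theorem IsSolutionOn.eqOn (h₁ : IsSolutionOn P Q γ₁ I) (h₂ : IsSolutionOn P Q γ₂ I)
    (hI : I.OrdConnected) {s : ℝ} (hs : s ∈ I) (heq : γ₁ s = γ₂ s) : Set.EqOn γ₁ γ₂ I := by
  intro t ht
  have hsub : Set.uIcc s t ⊆ I := hI.uIcc_subset hs ht
  have c₁ : ContinuousOn γ₁ (Set.uIcc s t) :=
    fun τ hτ => (h₁ τ (hsub hτ)).continuousAt.continuousWithinAt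
  have c₂ : ContinuousOn γ₂ (Set.uIcc s t) :=
    fun τ hτ => (h₂ τ (hsub hτ)).continuousAt.continuousWithinAt
  -- Both arcs lie in a compact set, on which the field is Lipschitz.
  obtain ⟨K, hK⟩ := LocallyLipschitzOn.exists_lipschitzOnWith_of_compact
    ((isCompact_uIcc.image_of_continuousOn c₁).union (isCompact_uIcc.image_of_continuousOn c₂))
    ((contDiff_field P Q).locallyLipschitz.locallyLipschitzOn)
  rcases le_total s t with hst | hst
  · rw [Set.uIcc_of_le hst] at *
    exact ODE_solution_unique_of_mem_Icc_right (v := fun _ => field P Q) (fun _ _ => hK) c₁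
      (fun τ hτ => (h₁ τ (hsub (Set.Ico_subset_Icc_self hτ))).hasDerivWithinAt)
      (fun τ hτ => Or.inl ⟨τ, Set.Ico_subset_Icc_self hτ, rfl⟩) c₂
      (fun τ hτ => (h₂ τ (hsub (Set.Ico_subset_Icc_self hτ))).hasDerivWithinAt)
      (fun τ hτ => Or.inr ⟨τ, Set.Ico_subset_Icc_self hτ, rfl⟩) heq ⟨hst, le_rfl⟩
  · rw [Set.uIcc_of_ge hst] at *
    exact ODE_solution_unique_of_mem_Icc_left (v := fun _ => field P Q) (fun _ _ => hK) c₁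
      (fun τ hτ => (h₁ τ (hsub (Set.Ioc_subset_Icc_self hτ))).hasDerivWithinAt)
      (fun τ hτ => Or.inl ⟨τ, Set.Ioc_subset_Icc_self hτ, rfl⟩) c₂
      (fun τ hτ => (h₂ τ (hsub (Set.Ioc_subset_Icc_self hτ))).hasDerivWithinAt)
      (fun τ hτ => Or.inr ⟨τ, Set.Ioc_subset_Icc_self hτ, rfl⟩) heq ⟨le_rfl, hst⟩

theorem mem_orbit_of_isSolutionOn (h : IsSolutionOn P Q γ I) (hIo : IsOpen I)
    (hIc : I.OrdConnected) {s t : ℝ} (hs : s ∈ I) (ht : t ∈ I) : γ t ∈ orbit P Q (γ s) :=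
  ⟨γ, I, hIo, hIc, h, s, hs, t, ht, rfl, rfl⟩

theorem mem_orbit_symm {p q : ℝ × ℝ} (h : q ∈ orbit P Q p) : p ∈ orbit P Q q := by
  obtain ⟨γ, I, hIo, hIc, hγ, s, hs, t, ht, hp, hq⟩ := h
  exact ⟨γ, I, hIo, hIc, hγ, t, ht, s, hs, hq, hp⟩

theorem mem_orbit_trans {p q r : ℝ × ℝ} (hpq : q ∈ orbit P Q p) (hqr : r ∈ orbit P Q q) :
    r ∈ orbit P Q p := by
  obtain ⟨γ, I, hIo, hIc, hγ, s, hs, t, ht, rfl, hq⟩ := hpq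
  obtain ⟨δ, J, hJo, hJc, hδ, a, ha, b, hb, hq', rfl⟩ := hqr
  -- Shift the time of the second solution so that both pass through `q` at time `t`.
  set J' : Set ℝ := (· + (a - t)) ⁻¹' J with hJ'
  have hJo' : IsOpen J' := hJo.preimage (by fun_prop)
  have hJc' : J'.OrdConnected := hJc.preimage_mono fun x y hxy => by simpa using hxy
  have htJ : t ∈ J' := by simpa [hJ'] using ha
  have hbJ : b - (a - t) ∈ J' := by simpa [hJ'] using hb
  have hδ' := hδ.comp_add_const (a - t)
  have heq : Set.EqOn γ (fun τ => δ (τ + (a - t))) (I ∩ J') :=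
    (hγ.mono Set.inter_subset_left).eqOn (hδ'.mono Set.inter_subset_right) (hIc.inter hJc')
      ⟨ht, htJ⟩ (by simp [hq, hq'])
  classical
  set η : ℝ → ℝ × ℝ := fun τ => if τ ∈ I then γ τ else δ (τ + (a - t)) with hη
  have hηI : Set.EqOn η γ I := fun τ hτ => by simp [hη, hτ]
  have hηJ : Set.EqOn η (fun τ => δ (τ + (a - t))) J' := fun τ hτ => by
    by_cases hI : τ ∈ I
    · rw [hηI hI, heq ⟨hI, hτ⟩]
    · simp [hη, hI]
  refine ⟨η, I ∪ J', hIo.union hJo', ?_, ?_, s, Or.inl hs, b - (a - t), Or.inr hbJ, hηI hs, ?_⟩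
  · exact (hIc.isPreconnected.union t ht htJ hJc'.isPreconnected).ordConnected
  · rintro τ (hτ | hτ)
    · rw [hηI hτ]
      exact (hγ τ hτ).congr_of_eventuallyEq (hηI.eventuallyEq_of_mem (hIo.mem_nhds hτ))
    · rw [hηJ hτ]
      exact (hδ' τ hτ).congr_of_eventuallyEq (hηJ.eventuallyEq_of_mem (hJo'.mem_nhds hτ))
  · rw [hηJ hbJ]
    simp

theorem orbit_eq_of_mem {p q : ℝ × ℝ} (h : q ∈ orbit P Q p) : orbit P Q q = orbit P Q p :=
  Set.Subset.antisymm (fun _ hr => mem_orbit_trans h hr)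
    fun _ hr => mem_orbit_trans (mem_orbit_symm h) hr

theorem orbit_subset_orbit_neg (P Q : MvPolynomial (Fin 2) ℝ) (p : ℝ × ℝ) :
    orbit P Q p ⊆ orbit (-P) (-Q) p := by
  rintro q ⟨γ, I, hIo, hIc, hγ, s, hs, t, ht, rfl, rfl⟩
  exact ⟨fun τ => γ (-τ), (fun τ => -τ) ⁻¹' I, hIo.preimage continuous_neg,
    hIc.preimage_anti fun x y hxy => neg_le_neg hxy, hγ.comp_neg,
    -s, by simpa using hs, -t, by simpa using ht, by simp, by simp⟩

theorem orbit_neg (P Q : MvPolynomial (Fin 2) ℝ) (p : ℝ × ℝ) :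
    orbit (-P) (-Q) p = orbit P Q p :=
  Set.Subset.antisymm (by simpa using orbit_subset_orbit_neg (-P) (-Q) p)
    (orbit_subset_orbit_neg P Q p)

theorem orbitsAlong_subset_neg (P Q : MvPolynomial (Fin 2) ℝ) (θ : ℝ) :
    orbitsAlong P Q θ ⊆ orbitsAlong (-P) (-Q) θ := by
  rintro O ⟨⟨p, hp⟩, γ, h⟩
  refine ⟨⟨p, by rw [orbit_neg, hp]⟩, fun t => γ (-t), ?_⟩
  rcases h with ⟨hγ, hO, h1, h2, h3⟩ | ⟨hγ, hO, h1, h2, h3⟩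
  · refine Or.inr ⟨hγ.comp_neg.mono fun t ht => ?_, fun t ht => hO _ ?_, ?_⟩
    · simpa using ht
    · simpa using ht
    · exact ⟨h1.comp tendsto_neg_atBot_atTop, h2.comp tendsto_neg_atBot_atTop,
        h3.comp tendsto_neg_atBot_atTop⟩
  · refine Or.inl ⟨hγ.comp_neg.mono fun t ht => ?_, fun t ht => hO _ ?_, ?_⟩
    · simpa using ht
    · simpa using ht
    · exact ⟨h1.comp tendsto_neg_atTop_atBot, h2.comp tendsto_neg_atTop_atBot,
        h3.comp tendsto_neg_atTop_atBot⟩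

/-- Reversing time changes neither the orbits nor which of them connect the origin. -/
theorem orbitsAlong_neg (P Q : MvPolynomial (Fin 2) ℝ) (θ : ℝ) :
    orbitsAlong (-P) (-Q) θ = orbitsAlong P Q θ :=
  Set.Subset.antisymm (by simpa using orbitsAlong_subset_neg (-P) (-Q) θ)
    (orbitsAlong_subset_neg P Q θ)

end HomogeneousPlanarSystem

/-! ### Solutions in a sector, found by quadrature -/

theorem exists_hasDerivAt_Ioo {ε u₀ : ℝ} (hu₀ : u₀ ∈ Set.Ioo 0 ε) {f : ℝ → ℝ}
    (hf : ContinuousOn f (Set.Ioo 0 ε)) :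
    ∃ F : ℝ → ℝ, F u₀ = 0 ∧ ∀ u ∈ Set.Ioo 0 ε, HasDerivAt F (f u) u := by
  refine ⟨fun u => ∫ s in u₀..u, f s, by simp, fun u hu => ?_⟩
  refine intervalIntegral.integral_hasDerivAt_right ?_ ?_ (hf.continuousAt (isOpen_Ioo.mem_nhds hu))
  · exact (hf.mono (Set.ordConnected_Ioo.uIcc_subset hu₀ hu)).intervalIntegrable
  · exact hf.stronglyMeasurableAtFilter isOpen_Ioo u hu

/-- The system `u' = y ^ k g(u)`, `y' = y ^ (k + 1) h(u)` with `g, h < 0` has, over `u ∈ (0, ε)`, a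
solution that reaches `u = y = 0` exactly as `t → ∞`. As a function of `u` it is
`y = Y(u) = exp ∫ h / g`, at the time `T(u) = ∫ du / (Y(u) ^ k g(u))`; both `Y → 0` and `T → ∞` as
`u → 0`, because `g` vanishes at least to first order. -/
theorem exists_solution_sector {ε K b : ℝ} (hε : 0 < ε) (hb : 0 < b) {g h : ℝ → ℝ}
    (hgc : ContinuousOn g (Set.Ioo 0 ε)) (hhc : ContinuousOn h (Set.Ioo 0 ε))
    (hg : ∀ u ∈ Set.Ioo 0 ε, g u < 0) (hgK : ∀ u ∈ Set.Ioo 0 ε, -g u ≤ K * u)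
    (hh : ∀ u ∈ Set.Ioo 0 ε, h u ≤ -b) (k : ℕ) :
    ∃ u y : ℝ → ℝ, (∀ t > 0, u t ∈ Set.Ioo 0 ε ∧ 0 < y t ∧ HasDerivAt u (y t ^ k * g (u t)) t ∧
      HasDerivAt y (y t ^ (k + 1) * h (u t)) t) ∧ Set.InjOn u (Set.Ioi 0) ∧
      Tendsto u atTop (𝓝 0) ∧ Tendsto y atTop (𝓝 0) := by
  have hu₀ : ε / 2 ∈ Set.Ioo 0 ε := ⟨by linarith, by linarith⟩
  set u₀ := ε / 2
  have hlt : ∀ {u}, u ∈ Set.Ioo 0 u₀ → u ∈ Set.Ioo 0 ε := fun hu => ⟨hu.1, hu.2.trans hu₀.2⟩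
  have hK : 0 < K := pos_of_mul_pos_left
    (lt_of_lt_of_le (neg_pos.mpr (hg u₀ hu₀)) (hgK u₀ hu₀)) hu₀.1.le
  obtain ⟨L, hL0, hL⟩ := exists_hasDerivAt_Ioo hu₀ (hhc.div hgc fun u hu => (hg u hu).ne)
  set Y : ℝ → ℝ := fun u => Real.exp (L u) with hY
  have hYpos : ∀ u, 0 < Y u := fun u => Real.exp_pos _
  have hYd : ∀ u ∈ Set.Ioo 0 ε, HasDerivAt Y (Y u * (h u / g u)) u := fun u hu => (hL u hu).exp
  have hYc : ContinuousOn Y (Set.Ioo 0 ε) :=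
    fun u hu => (hYd u hu).continuousAt.continuousWithinAt
  obtain ⟨T, hT0, hT⟩ := exists_hasDerivAt_Ioo hu₀ (f := fun u => (Y u ^ k * g u)⁻¹)
    (((hYc.pow k).mul hgc).inv₀ fun u hu => (mul_neg_of_pos_of_neg (pow_pos (hYpos u) k)
      (hg u hu)).ne)
  have hTneg : ∀ u ∈ Set.Ioo 0 ε, (Y u ^ k * g u)⁻¹ < 0 := fun u hu =>
    inv_lt_zero.mpr (mul_neg_of_pos_of_neg (pow_pos (hYpos u) k) (hg u hu))
  have hTc : ContinuousOn T (Set.Ioo 0 ε) :=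
    fun u hu => (hT u hu).continuousAt.continuousWithinAt
  have hTanti : StrictAntiOn T (Set.Ioo 0 ε) := by
    refine strictAntiOn_of_deriv_neg (convex_Ioo 0 ε) hTc fun u hu => ?_
    rw [interior_Ioo] at hu
    rw [(hT u hu).deriv]
    exact hTneg u hu
  -- Comparison with the logarithm: `h / g ≥ (b / K) / u`.
  have hquot : ∀ u ∈ Set.Ioo 0 ε, b / K * u⁻¹ ≤ h u / g u := fun u hu => by
    have h1 := hg u hu
    have h2 := hgK u hu
    have h3 := hh u hu
    rw [← neg_div_neg_eq (h u), le_div_iff₀ (by linarith)]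
    calc b / K * u⁻¹ * -g u ≤ b / K * u⁻¹ * (K * u) := by
          have := hu.1
          gcongr
      _ = b := by
          have := hu.1
          field_simp
      _ ≤ -h u := by linarith
  have hLlog : ∀ u ∈ Set.Ioo 0 u₀, L u ≤ b / K * (Real.log u - Real.log u₀) := by
    intro u hu
    have hmono : MonotoneOn (fun u => L u - b / K * Real.log u) (Set.Ioo 0 ε) := by
      have hd : ∀ u ∈ Set.Ioo 0 ε, HasDerivAt (fun u => L u - b / K * Real.log u)
          (h u / g u - b / K * u⁻¹) u := fun u hu =>
        (hL u hu).sub ((Real.hasDerivAt_log hu.1.ne').const_mul _)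
      refine monotoneOn_of_deriv_nonneg (convex_Ioo 0 ε)
        (fun u hu => (hd u hu).continuousAt.continuousWithinAt)
        (fun u hu => ?_) fun u hu => ?_ <;> rw [interior_Ioo] at *
      · exact (hd u hu).differentiableAt.differentiableWithinAt
      · rw [(hd u hu).deriv]
        exact sub_nonneg.mpr (hquot u hu)
    have := hmono (hlt hu) hu₀ hu.2.le
    simp only [hL0] at this
    linarith
  have hYle : ∀ u ∈ Set.Ioo 0 u₀, Y u ≤ 1 := fun u hu => by
    refine Real.exp_le_one_iff.mpr ((hLlog u hu).trans ?_)
    exact mul_nonpos_of_nonneg_of_nonpos (by positivity)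
      (sub_nonpos.mpr (Real.log_le_log hu.1 hu.2.le))
  have hTlog : ∀ u ∈ Set.Ioo 0 u₀, K⁻¹ * (Real.log u₀ - Real.log u) ≤ T u := by
    intro u hu
    have hanti : AntitoneOn (fun u => T u + K⁻¹ * Real.log u) (Set.Ioc 0 u₀) := by
      have hd : ∀ u ∈ Set.Ioc 0 u₀, HasDerivAt (fun u => T u + K⁻¹ * Real.log u)
          ((Y u ^ k * g u)⁻¹ + K⁻¹ * u⁻¹) u := fun u hu =>
        (hT u ⟨hu.1, hu.2.trans_lt hu₀.2⟩).add ((Real.hasDerivAt_log hu.1.ne').const_mul _)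
      refine antitoneOn_of_deriv_nonpos (convex_Ioc 0 u₀)
        (fun u hu => (hd u hu).continuousAt.continuousWithinAt)
        (fun u hu => ?_) fun u hu => ?_ <;> rw [interior_Ioc] at *
      · exact (hd u ⟨hu.1, hu.2.le⟩).differentiableAt.differentiableWithinAt
      · rw [(hd u ⟨hu.1, hu.2.le⟩).deriv]
        have h1 := hg u (hlt hu)
        have h2 := hgK u (hlt hu)
        have h3 : Y u ^ k ≤ 1 := pow_le_one₀ (hYpos u).le (hYle u hu)
        have h4 : 0 < Y u ^ k := pow_pos (hYpos u) k
        have h5 : Y u ^ k * -g u ≤ K * u := by nlinarith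
        have h6 : (K * u)⁻¹ ≤ (Y u ^ k * -g u)⁻¹ := inv_anti₀ (mul_pos h4 (by linarith)) h5
        rw [mul_neg, inv_neg, mul_inv] at h6
        linarith
    have := hanti ⟨hu.1, hu.2.le⟩ ⟨hu₀.1, le_rfl⟩ hu.2.le
    simp only [hT0] at this
    linarith
  have hTtop : Tendsto T (𝓝[>] 0) atTop := by
    refine tendsto_atTop_mono' _ (f₁ := fun u => K⁻¹ * (Real.log u₀ - Real.log u)) ?_ ?_
    · filter_upwards [Ioo_mem_nhdsGT hu₀.1] with u hu using hTlog u hu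
    · refine Tendsto.const_mul_atTop (by positivity) ?_
      exact tendsto_atTop_add_const_left _ _ (tendsto_neg_atBot_atTop.comp
        Real.tendsto_log_nhdsGT_zero)
  have hYzero : Tendsto Y (𝓝[>] 0) (𝓝 0) := by
    refine Real.tendsto_exp_atBot.comp ?_
    refine tendsto_atBot_mono' _ (f₁ := fun u => b / K * (Real.log u - Real.log u₀)) ?_ ?_
    · filter_upwards [Ioo_mem_nhdsGT hu₀.1] with u hu using hLlog u hu
    · refine Tendsto.const_mul_atBot (by positivity) ?_
      exact tendsto_atBot_add_const_right _ _ Real.tendsto_log_nhdsGT_zero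
  -- `T` maps `(0, u₀)` onto `(0, ∞)`; its inverse is the sought `u`.
  have hsurj : ∀ t > 0, ∃ u ∈ Set.Ioo 0 u₀, T u = t := by
    intro t ht
    obtain ⟨v, hv, hvt⟩ := ((hTtop.eventually_gt_atTop t).and
      (Ioo_mem_nhdsGT hu₀.1)).exists.imp fun v hv => hv.symm
    obtain ⟨u, hu, hut⟩ := intermediate_value_Icc' hv.2.le
      (hTc.mono fun w hw => ⟨hv.1.trans_le hw.1, hw.2.trans_lt hu₀.2⟩)
      (show t ∈ Set.Icc (T u₀) (T v) from ⟨hT0 ▸ ht.le, hvt.le⟩)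
    refine ⟨u, ⟨hv.1.trans_le hu.1, lt_of_le_of_ne hu.2 ?_⟩, hut⟩
    rintro rfl
    exact ht.ne' (hut.symm.trans hT0)
  choose! U hU hTU using hsurj
  have hUT : ∀ u ∈ Set.Ioo 0 u₀, 0 < T u ∧ U (T u) = u := fun u hu => by
    have hpos : 0 < T u := hT0 ▸ hTanti (hlt hu) hu₀ hu.2
    exact ⟨hpos, hTanti.injOn (hlt (hU _ hpos)) (hlt hu) (hTU _ hpos)⟩
  have hUanti : ∀ s > 0, ∀ t > 0, s ≤ t → U t ≤ U s := fun s hs t ht hst => by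
    by_contra hlt'
    have := hTanti (hlt (hU s hs)) (hlt (hU t ht)) (not_le.mp hlt')
    rw [hTU s hs, hTU t ht] at this
    linarith
  have hUc : ∀ t > 0, ContinuousAt U t := by
    intro t ht
    have hmono : MonotoneOn (fun s => -U s) (Set.Ioi 0) :=
      fun s hs r hr hsr => neg_le_neg (hUanti s hs r hr hsr)
    have himage : (fun s => -U s) '' Set.Ioi 0 ∈ 𝓝 (-U t) := by
      refine mem_of_superset (isOpen_Ioo.mem_nhds
        (show -U t ∈ Set.Ioo (-u₀) 0 from ⟨neg_lt_neg (hU t ht).2, neg_neg_iff_pos.mpr (hU t ht).1⟩))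
        fun v hv => ?_
      have hv' : -v ∈ Set.Ioo 0 u₀ := ⟨neg_pos.mpr hv.2, by linarith [hv.1]⟩
      exact ⟨T (-v), (hUT _ hv').1, by simp [(hUT _ hv').2]⟩
    have := (continuousAt_of_monotoneOn_of_image_mem_nhds hmono (Ioi_mem_nhds ht) himage).fun_neg
    simpa only [neg_neg] using this
  have hUd : ∀ t > 0, HasDerivAt U (Y (U t) ^ k * g (U t)) t := by
    intro t ht
    have := HasDerivAt.of_local_left_inverse (hUc t ht) (hT _ (hlt (hU t ht)))
      (hTneg _ (hlt (hU t ht))).ne (by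
        filter_upwards [Ioi_mem_nhds ht] with s hs using hTU s hs)
    simpa using this
  have hUzero : Tendsto U atTop (𝓝[>] 0) := by
    refine tendsto_nhdsWithin_iff.mpr ⟨?_, ?_⟩
    · rw [Metric.tendsto_atTop]
      intro δ hδ
      have hv : min (u₀ / 2) (δ / 2) ∈ Set.Ioo 0 u₀ :=
        ⟨lt_min (half_pos hu₀.1) (half_pos hδ),
          (min_le_left _ _).trans_lt (half_lt_self hu₀.1)⟩
      refine ⟨T (min (u₀ / 2) (δ / 2)), fun t ht => ?_⟩
      have hpos := (hUT _ hv).1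
      have h1 := hUanti _ hpos t (hpos.trans_le ht) ht
      rw [(hUT _ hv).2] at h1
      have h2 := hU t (hpos.trans_le ht)
      rw [Real.dist_eq, sub_zero, abs_of_pos h2.1]
      linarith [min_le_right (u₀ / 2) (δ / 2)]
    · filter_upwards [eventually_gt_atTop 0] with t ht using (hU t ht).1
  refine ⟨U, fun t => Y (U t), fun t ht => ⟨hlt (hU t ht), hYpos _, hUd t ht, ?_⟩, ?_, ?_, ?_⟩
  · have h1 := (hYd _ (hlt (hU t ht))).comp t (hUd t ht)
    have h2 := (hg _ (hlt (hU t ht))).ne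
    convert! h1 using 1
    field_simp
    ring
  · intro s hs t ht hst
    rw [← hTU s hs, ← hTU t ht, hst]
  · exact hUzero.mono_right nhdsWithin_le_nhds
  · exact hYzero.comp hUzero

/-! ### The projective coordinate `u = x / y` on the upper half plane -/

namespace HomogeneousPlanarSystem

open MvPolynomial

/-- The polynomial `P(u, 1) - u Q(u, 1)`. In the coordinate `u = x / y` the system with `P`, `Q`
homogeneous of degree `k + 1` reads `u' = y ^ k slopeRate(u)`, `y' = y ^ (k + 1) Q(u, 1)`. -/
noncomputable def slopeRate (P Q : MvPolynomial (Fin 2) ℝ) (u : ℝ) : ℝ :=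
  eval ![u, 1] P - u * eval ![u, 1] Q

variable {P Q : MvPolynomial (Fin 2) ℝ} {k : ℕ}

theorem slopeRate_eq_neg_eval_G (P Q : MvPolynomial (Fin 2) ℝ) (u : ℝ) :
    slopeRate P Q u = -eval ![u, 1] (G P Q) := by
  simp [slopeRate, G]

theorem slopeRate_neg (P Q : MvPolynomial (Fin 2) ℝ) (u : ℝ) :
    slopeRate (-P) (-Q) u = -slopeRate P Q u := by
  simp only [slopeRate, map_neg]
  ring

theorem analyticAt_slopeRate (P Q : MvPolynomial (Fin 2) ℝ) (u : ℝ) :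
    AnalyticAt ℝ (slopeRate P Q) u :=
  (analyticAt_eval_comp P analyticAt_id analyticAt_const).sub
    (analyticAt_id.mul (analyticAt_eval_comp Q analyticAt_id analyticAt_const))

theorem eval_mul_self {p : MvPolynomial (Fin 2) ℝ} {n : ℕ} (hp : p.IsHomogeneous n) (w y : ℝ) :
    eval ![w * y, y] p = y ^ n * eval ![w, 1] p := by
  rw [← eval_smul_of_isHomogeneous hp, mul_comm w, mul_one]

theorem hasDerivAt_of_slope (hP : P.IsHomogeneous (k + 1)) (hQ : Q.IsHomogeneous (k + 1))
    {w y : ℝ → ℝ} {t : ℝ} (hw : HasDerivAt w (y t ^ k * slopeRate P Q (w t)) t)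
    (hy : HasDerivAt y (y t ^ (k + 1) * eval ![w t, 1] Q) t) :
    HasDerivAt (fun s => (w s * y s, y s)) (field P Q (w t * y t, y t)) t := by
  convert! (hw.mul hy).prodMk hy using 1
  simp only [field, eval_mul_self hP, eval_mul_self hQ, slopeRate]
  ext <;> simp only
  ring

theorem hasDerivAt_slope (hP : P.IsHomogeneous (k + 1)) (hQ : Q.IsHomogeneous (k + 1))
    {γ : ℝ → ℝ × ℝ} {t : ℝ} (hγ : HasDerivAt γ (field P Q (γ t)) t) (hy : (γ t).2 ≠ 0) :
    HasDerivAt (fun s => (γ s).1 / (γ s).2)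
        ((γ t).2 ^ k * slopeRate P Q ((γ t).1 / (γ t).2)) t ∧
      HasDerivAt (fun s => (γ s).2) ((γ t).2 ^ (k + 1) * eval ![(γ t).1 / (γ t).2, 1] Q) t := by
  have h1 : HasDerivAt (fun s => (γ s).1) (eval ![(γ t).1, (γ t).2] P) t := hγ.fst
  have h2 : HasDerivAt (fun s => (γ s).2) (eval ![(γ t).1, (γ t).2] Q) t := hγ.snd
  have key : ∀ {p : MvPolynomial (Fin 2) ℝ}, p.IsHomogeneous (k + 1) →
      eval ![(γ t).1, (γ t).2] p = (γ t).2 ^ (k + 1) * eval ![(γ t).1 / (γ t).2, 1] p := by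
    intro p hp
    rw [← eval_mul_self hp, div_mul_cancel₀ _ hy]
  refine ⟨?_, key hQ ▸ h2⟩
  convert! h1.div h2 hy using 1
  rw [key hP, key hQ, slopeRate]
  field_simp
  ring

theorem tendsToOriginAlong_pi_div_two {w y : ℝ → ℝ} {l : Filter ℝ} (hw : Tendsto w l (𝓝 0))
    (hy : Tendsto y l (𝓝 0)) (hpos : ∀ᶠ t in l, 0 < y t) :
    TendsToOriginAlong (fun t => (w t * y t, y t)) l (Real.pi / 2) := by
  have hsqrt : ∀ᶠ t in l, √((w t * y t) ^ 2 + y t ^ 2) = y t * √(w t ^ 2 + 1) := by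
    filter_upwards [hpos] with t ht
    rw [show (w t * y t) ^ 2 + y t ^ 2 = y t ^ 2 * (w t ^ 2 + 1) by ring,
      Real.sqrt_mul (sq_nonneg _), Real.sqrt_sq ht.le]
  have hroot : Tendsto (fun t => √(w t ^ 2 + 1)) l (𝓝 1) := by
    simpa using ((hw.pow 2).add_const 1).sqrt
  refine ⟨?_, ?_, ?_⟩
  · simpa [← Prod.mk_zero_zero] using (hw.mul hy).prodMk_nhds hy
  · rw [Real.cos_pi_div_two]
    have : Tendsto (fun t => w t / √(w t ^ 2 + 1)) l (𝓝 0) := by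
      simpa [Pi.div_def] using hw.div hroot one_ne_zero
    refine this.congr' ?_
    filter_upwards [hsqrt, hpos] with t ht ht'
    rw [ht, mul_comm (w t), mul_div_mul_left _ _ ht'.ne']
  · rw [Real.sin_pi_div_two]
    have : Tendsto (fun t => 1 / √(w t ^ 2 + 1)) l (𝓝 1) := by
      simpa using hroot.inv₀ one_ne_zero
    refine this.congr' ?_
    filter_upwards [hsqrt, hpos] with t ht ht'
    rw [ht, ← mul_div_mul_left _ _ ht'.ne', mul_one]

theorem TendsToOriginAlong.slope {γ : ℝ → ℝ × ℝ} {l : Filter ℝ}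
    (h : TendsToOriginAlong γ l (Real.pi / 2)) :
    (∀ᶠ t in l, 0 < (γ t).2) ∧ Tendsto (fun t => (γ t).1 / (γ t).2) l (𝓝 0) ∧
      Tendsto (fun t => (γ t).2) l (𝓝 0) := by
  obtain ⟨h0, h1, h2⟩ := h
  rw [Real.cos_pi_div_two] at h1
  rw [Real.sin_pi_div_two] at h2
  have hev := h2.eventually (lt_mem_nhds zero_lt_one)
  refine ⟨?_, ?_, (continuous_snd.tendsto _).comp h0⟩
  · filter_upwards [hev] with t ht
    by_contra hle
    exact ht.not_ge (div_nonpos_of_nonpos_of_nonneg (not_lt.mp hle) (Real.sqrt_nonneg _))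
  · have h3 := h1.div h2 one_ne_zero
    rw [zero_div] at h3
    refine h3.congr' ?_
    filter_upwards [hev] with t ht
    refine div_div_div_cancel_right₀ (fun hs => ?_) _ _
    rw [hs, div_zero] at ht
    exact ht.ne rfl

/-! ### Infinitely many orbits in an attracting sector -/

/-- If a solution with positive ordinate has pairwise distinct slopes `x / y` at all positive
times, then its dilates lie on pairwise distinct orbits: the dilates of one point have the same
slope, and a solution joining two of them would follow a dilate of the given solution. -/
theorem orbit_smul_ne (hP : P.IsHomogeneous (k + 1)) (hQ : Q.IsHomogeneous (k + 1))
    {γ : ℝ → ℝ × ℝ} (hγ : IsSolutionOn P Q γ (Set.Ioi 0)) (hpos : ∀ t > 0, 0 < (γ t).2)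
    (hinj : Set.InjOn (fun t => (γ t).1 / (γ t).2) (Set.Ioi 0)) :
    Set.InjOn (fun c : ℝ => orbit P Q (c • γ 1)) (Set.Ioi 0) := by
  have hdil : ∀ c > 0, IsSolutionOn P Q (fun t => c • γ (c ^ k * t)) (Set.Ioi 0) := fun c hc =>
    (hγ.dilate hP hQ c).mono fun t ht => mul_pos (pow_pos hc k) ht
  have hpoint : ∀ c > 0, c • γ (c ^ k * (c ^ k)⁻¹) = c • γ 1 := fun c hc => by
    rw [mul_inv_cancel₀ (pow_pos hc k).ne']
  have key : ∀ a > (0 : ℝ), ∀ b > (0 : ℝ), ∀ (δ : ℝ → ℝ × ℝ) (I : Set ℝ), I.OrdConnected →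
      IsSolutionOn P Q δ I → ∀ s ∈ I, ∀ t ∈ I, s ≤ t → δ s = a • γ 1 → δ t = b • γ 1 →
      a = b := by
    intro a ha b hb δ I hI hδ s hs t ht hst hδs hδt
    have hak : 0 < (a ^ k)⁻¹ := inv_pos.mpr (pow_pos ha k)
    have heq := (hδ.mono (hI.out hs ht)).eqOn
      (((hdil a ha).comp_add_const ((a ^ k)⁻¹ - s)).mono fun τ hτ => by
        have := hτ.1
        simp only [Set.mem_preimage, Set.mem_Ioi]
        linarith) Set.ordConnected_Icc (Set.left_mem_Icc.mpr hst)
      (by simpa [hδs] using (hpoint a ha).symm)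
    have h1 := heq (Set.right_mem_Icc.mpr hst)
    simp only [hδt] at h1
    set τ : ℝ := a ^ k * (t + ((a ^ k)⁻¹ - s)) with hτ
    have hτpos : 0 < τ := mul_pos (pow_pos ha k) (by linarith)
    have hslope : (γ 1).1 / (γ 1).2 = (γ τ).1 / (γ τ).2 := by
      have e1 : b * (γ 1).1 = a * (γ τ).1 := congrArg Prod.fst h1
      have e2 : b * (γ 1).2 = a * (γ τ).2 := congrArg Prod.snd h1
      rw [← mul_div_mul_left _ _ hb.ne', e1, e2, mul_div_mul_left _ _ ha.ne']
    have hτ1 : 1 = τ := hinj (Set.mem_Ioi.mpr one_pos) hτpos hslope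
    rw [← hτ1] at h1
    have e2 : b * (γ 1).2 = a * (γ 1).2 := congrArg Prod.snd h1
    exact (mul_right_cancel₀ (hpos 1 one_pos).ne' e2).symm
  intro a ha b hb hab
  have hmem : b • γ 1 ∈ orbit P Q (a • γ 1) := by
    rw [show orbit P Q (a • γ 1) = orbit P Q (b • γ 1) from hab]
    have hbk : (b ^ k)⁻¹ ∈ Set.Ioi (0 : ℝ) := Set.mem_Ioi.mpr (inv_pos.mpr (pow_pos hb k))
    simpa only [hpoint b hb] using
      mem_orbit_of_isSolutionOn (hdil b hb) isOpen_Ioi Set.ordConnected_Ioi hbk hbk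
  obtain ⟨δ, I, -, hI, hδ, s, hs, t, ht, hδs, hδt⟩ := hmem
  rcases le_total s t with hst | hst
  · exact key a ha b hb δ I hI hδ s hs t ht hst hδs hδt
  · exact (key b hb a ha δ I hI hδ t ht s hs hst hδt hδs).symm

/-- Suppose the `y`-axis attracts in its upper half (`Q(0, 1) < 0`). If the slope `x / y` decreases
in absolute value on one side of it (`σ = 1` for the right, `σ = -1` for the left), then all
solutions in a thin sector on that side connect the origin. -/
theorem infinite_orbitsAlong_of_sector (hP : P.IsHomogeneous (k + 1))
    (hQ : Q.IsHomogeneous (k + 1)) (hP0 : eval ![0, 1] P = 0) (hQ0 : eval ![0, 1] Q < 0)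
    {σ : ℝ} (hσ : σ * σ = 1) (hslope : ∀ᶠ u in 𝓝[>] 0, σ * slopeRate P Q (σ * u) < 0) :
    (orbitsAlong P Q (Real.pi / 2)).Infinite := by
  have hσ0 : σ ≠ 0 := by
    rintro rfl
    norm_num at hσ
  have hg : Continuous fun u => σ * slopeRate P Q (σ * u) :=
    continuous_const.mul ((continuous_iff_continuousAt.mpr fun u =>
      (analyticAt_slopeRate P Q u).continuousAt).comp (continuous_const.mul continuous_id))
  have hh : Continuous fun u => eval ![σ * u, 1] Q :=
    (continuous_eval_left Q).comp (continuous_const.mul continuous_id)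
  obtain ⟨K, hK⟩ : ∃ K, ∀ᶠ u in 𝓝 (0 : ℝ), |slopeRate P Q (σ * u)| ≤ K * |u| := by
    have hd : DifferentiableAt ℝ (fun u => slopeRate P Q (σ * u)) 0 := by
      refine DifferentiableAt.comp (g := slopeRate P Q) 0
        (analyticAt_slopeRate P Q _).differentiableAt (by fun_prop)
    obtain ⟨K, hK⟩ := hd.isBigO_sub.bound
    refine ⟨K, hK.mono fun u hu => ?_⟩
    simpa [slopeRate, hP0] using hu
  have hb : ∀ᶠ u in 𝓝 (0 : ℝ), eval ![σ * u, 1] Q < eval ![0, 1] Q / 2 := by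
    refine hh.continuousAt.eventually_lt continuousAt_const ?_
    simp only [mul_zero]
    linarith
  obtain ⟨ε, hε, hεs⟩ := mem_nhdsGT_iff_exists_Ioo_subset.mp
    (hslope.and ((hK.and hb).filter_mono nhdsWithin_le_nhds))
  have habs : |σ| = 1 := by
    have := abs_mul_abs_self σ
    rw [hσ] at this
    nlinarith [abs_nonneg σ]
  obtain ⟨u, y, hsol, hinj, hu, hy⟩ := exists_solution_sector hε
    (b := -(eval ![0, 1] Q / 2)) (by linarith) hg.continuousOn hh.continuousOn
    (fun u hu => (hεs hu).1) (K := K)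
    (fun u hu => by
      have h1 := (hεs hu).2.1
      rw [abs_of_pos hu.1] at h1
      calc -(σ * slopeRate P Q (σ * u)) ≤ |σ * slopeRate P Q (σ * u)| := neg_le_abs _
        _ = |slopeRate P Q (σ * u)| := by rw [abs_mul, habs, one_mul]
        _ ≤ K * u := h1)
    (fun u hu => by
      have := (hεs hu).2.2
      linarith) k
  set γ : ℝ → ℝ × ℝ := fun t => (σ * u t * y t, y t) with hγdef
  have hγ : IsSolutionOn P Q γ (Set.Ioi 0) := fun t ht => by
    obtain ⟨-, -, h1, h2⟩ := hsol t ht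
    refine hasDerivAt_of_slope (w := fun s => σ * u s) hP hQ ?_ h2
    convert! h1.const_mul σ using 1
    linear_combination (-(y t ^ k * slopeRate P Q (σ * u t))) * hσ
  have hpos : ∀ t > 0, 0 < (γ t).2 := fun t ht => (hsol t ht).2.1
  have hinj' : Set.InjOn (fun t => (γ t).1 / (γ t).2) (Set.Ioi 0) := by
    intro s hs t ht hst
    have e : ∀ r ∈ Set.Ioi (0 : ℝ), (γ r).1 / (γ r).2 = σ * u r := fun r hr =>
      mul_div_cancel_right₀ _ (hpos r hr).ne'
    simp only [e s hs, e t ht] at hst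
    exact hinj hs ht (mul_left_cancel₀ hσ0 hst)
  refine Set.infinite_of_injOn_mapsTo (orbit_smul_ne hP hQ hγ hpos hinj') (fun c hc => ?_)
    (Set.Ioi_infinite 0)
  have hck : 0 < c ^ k := pow_pos hc k
  have hsolc : IsSolutionOn P Q (fun t => c • γ (c ^ k * t)) (Set.Ioi 0) :=
    (hγ.dilate hP hQ c).mono fun t ht => mul_pos hck ht
  refine ⟨⟨_, rfl⟩, fun t => c • γ (c ^ k * t), Or.inl ⟨hsolc, fun t ht => ?_, ?_⟩⟩
  · have := mem_orbit_of_isSolutionOn hsolc isOpen_Ioi Set.ordConnected_Ioi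
      (Set.mem_Ioi.mpr (inv_pos.mpr hck)) ht
    simpa only [mul_inv_cancel₀ hck.ne'] using this
  · have htop : Tendsto (fun t : ℝ => c ^ k * t) atTop atTop := tendsto_id.const_mul_atTop hck
    have := tendsToOriginAlong_pi_div_two (w := fun t => σ * u (c ^ k * t))
      (y := fun t => c * y (c ^ k * t)) (l := atTop)
      (by simpa using (hu.comp htop).const_mul σ) (by simpa using (hy.comp htop).const_mul c)
      (by
        filter_upwards [eventually_gt_atTop 0] with t ht
        exact mul_pos hc (hpos _ (mul_pos hck ht)))
    convert! this using 1
    ext t <;> simp [hγdef]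
    ring

/-! ### The orbit on the axis and its uniqueness -/

/-- The solution `y = (j t) ^ (-1 / k)` of `y' = -(j / k) y ^ (k + 1)`. -/
theorem hasDerivAt_rpow_solution {j : ℝ} (hj : 0 < j) (hk : k ≠ 0) {t : ℝ} (ht : 0 < t) :
    HasDerivAt (fun s => (j * s) ^ (-(k : ℝ)⁻¹))
      (((j * t) ^ (-(k : ℝ)⁻¹)) ^ (k + 1) * -(j / k)) t := by
  have hk' : (k : ℝ) ≠ 0 := Nat.cast_ne_zero.mpr hk
  have h1 : HasDerivAt (fun s => j * s) j t := by simpa using (hasDerivAt_id t).const_mul j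
  have hjt : 0 < j * t := mul_pos hj ht
  have h2 := h1.rpow_const (p := -(k : ℝ)⁻¹) (Or.inl hjt.ne')
  convert! h2 using 1
  rw [← Real.rpow_natCast, ← Real.rpow_mul hjt.le]
  have : -(k : ℝ)⁻¹ * ((k + 1 : ℕ) : ℝ) = -(k : ℝ)⁻¹ - 1 := by
    push_cast
    field_simp
    ring
  rw [this]
  ring

theorem exists_solution_axis (hk : k ≠ 0) (hP : P.IsHomogeneous (k + 1))
    (hQ : Q.IsHomogeneous (k + 1)) (hP0 : eval ![0, 1] P = 0) (hQ0 : eval ![0, 1] Q < 0) :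
    ∃ y : ℝ → ℝ, IsSolutionOn P Q (fun t => (0, y t)) (Set.Ioi 0) ∧ (∀ t > 0, 0 < y t) ∧
      Tendsto y atTop (𝓝 0) ∧ ∀ r > 0, ∃ t > 0, y t = r := by
  have hk' : (0 : ℝ) < k := Nat.cast_pos.mpr (Nat.pos_of_ne_zero hk)
  obtain ⟨j, hj, hjQ⟩ : ∃ j : ℝ, 0 < j ∧ eval ![0, 1] Q = -(j / k) :=
    ⟨-(k * eval ![0, 1] Q), neg_pos.mpr (mul_neg_of_pos_of_neg hk' hQ0), by field_simp⟩
  refine ⟨fun t => (j * t) ^ (-(k : ℝ)⁻¹), fun t ht => ?_, fun t ht => ?_, ?_, fun r hr => ?_⟩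
  · have h0 : HasDerivAt (fun _ : ℝ => (0 : ℝ))
        (((j * t) ^ (-(k : ℝ)⁻¹)) ^ k * slopeRate P Q 0) t := by
      simpa [slopeRate, hP0] using hasDerivAt_const t (0 : ℝ)
    have h1 := hasDerivAt_rpow_solution hj hk ht
    rw [← hjQ] at h1
    simpa using hasDerivAt_of_slope (w := fun _ => 0)
      (y := fun s => (j * s) ^ (-(k : ℝ)⁻¹)) hP hQ h0 h1
  · exact Real.rpow_pos_of_pos (mul_pos hj ht) _
  · exact (tendsto_rpow_neg_atTop (inv_pos.mpr hk')).comp (tendsto_id.const_mul_atTop hj)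
  · refine ⟨r ^ (-(k : ℝ)) / j, div_pos (Real.rpow_pos_of_pos hr _) hj, ?_⟩
    simp only [mul_div_cancel₀ _ hj.ne']
    rw [← Real.rpow_mul hr.le]
    simp [hk'.ne']

/-- A solution that approaches the origin along the direction `π / 2` in forward time, while
`|x / y|` does not decrease near that direction, ends up on the positive `y`-axis: `(x / y) ^ 2` is
nondecreasing and tends to `0`. -/
theorem exists_mem_axis_of_tendsto (hP : P.IsHomogeneous (k + 1)) (hQ : Q.IsHomogeneous (k + 1))
    (hslope : ∀ᶠ u in 𝓝 0, 0 ≤ u * slopeRate P Q u) {γ : ℝ → ℝ × ℝ}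
    (hγ : IsSolutionOn P Q γ (Set.Ioi 0)) (hlim : TendsToOriginAlong γ atTop (Real.pi / 2)) :
    ∃ t > 0, (γ t).1 = 0 ∧ 0 < (γ t).2 := by
  obtain ⟨hpos, hw, -⟩ := hlim.slope
  obtain ⟨T, hT⟩ := eventually_atTop.mp
    ((hpos.and (hw.eventually hslope)).and (eventually_gt_atTop (0 : ℝ)))
  set w : ℝ → ℝ := fun t => (γ t).1 / (γ t).2 with hwdef
  have hd : ∀ t ∈ Set.Ici T, HasDerivAt (fun s => w s ^ 2)
      (2 * (γ t).2 ^ k * (w t * slopeRate P Q (w t))) t := fun t ht => by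
    obtain ⟨⟨h1, -⟩, h3⟩ := hT t ht
    have := ((hasDerivAt_slope hP hQ (hγ t h3) h1.ne').1).fun_pow 2
    convert! this using 1
    simp only [hwdef]
    push_cast
    ring
  have hmono : MonotoneOn (fun s => w s ^ 2) (Set.Ici T) := by
    refine monotoneOn_of_deriv_nonneg (convex_Ici T)
      (fun t ht => (hd t ht).continuousAt.continuousWithinAt)
      (fun t ht => (hd t (interior_subset ht)).differentiableAt.differentiableWithinAt)
      fun t ht => ?_
    have ht' := interior_subset ht
    rw [(hd t ht').deriv]
    obtain ⟨⟨h1, h2⟩, -⟩ := hT t ht'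
    exact mul_nonneg (mul_nonneg zero_le_two (pow_nonneg h1.le k)) h2
  have hlim2 : Tendsto (fun s => w s ^ 2) atTop (𝓝 0) := by simpa using hw.pow 2
  have hle : w T ^ 2 ≤ 0 := ge_of_tendsto hlim2 (by
    filter_upwards [eventually_ge_atTop T] with t ht using hmono Set.self_mem_Ici ht ht)
  obtain ⟨⟨h1, -⟩, h3⟩ := hT T le_rfl
  have hw0 : w T = 0 := pow_eq_zero_iff two_ne_zero |>.mp (le_antisymm hle (sq_nonneg _))
  exact ⟨T, h3, (div_eq_zero_iff.mp hw0).resolve_right h1.ne', h1⟩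

/-- Where `Q(0, 1) < 0`, the ordinate decreases near the direction `π / 2`, so the origin is not
approached in backward time. -/
theorem not_tendsToOriginAlong_atBot (hP : P.IsHomogeneous (k + 1))
    (hQ : Q.IsHomogeneous (k + 1)) (hQ0 : eval ![0, 1] Q < 0) {γ : ℝ → ℝ × ℝ}
    (hγ : IsSolutionOn P Q γ (Set.Iio 0)) : ¬TendsToOriginAlong γ atBot (Real.pi / 2) := by
  intro hlim
  obtain ⟨hpos, hw, hy⟩ := hlim.slope
  have hneg : ∀ᶠ u in 𝓝 (0 : ℝ), eval ![u, 1] Q < 0 :=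
    (continuous_eval_left Q).continuousAt.eventually_lt continuousAt_const hQ0
  obtain ⟨T, hT⟩ := eventually_atBot.mp
    ((hpos.and (hw.eventually hneg)).and (eventually_lt_atBot (0 : ℝ)))
  have hd : ∀ t ∈ Set.Iic T, HasDerivAt (fun s => (γ s).2)
      ((γ t).2 ^ (k + 1) * eval ![(γ t).1 / (γ t).2, 1] Q) t := fun t ht =>
    (hasDerivAt_slope hP hQ (hγ t (hT t ht).2) (hT t ht).1.1.ne').2
  have hanti : AntitoneOn (fun s => (γ s).2) (Set.Iic T) := by
    refine antitoneOn_of_deriv_nonpos (convex_Iic T)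
      (fun t ht => (hd t ht).continuousAt.continuousWithinAt)
      (fun t ht => (hd t (interior_subset ht)).differentiableAt.differentiableWithinAt)
      fun t ht => ?_
    have ht' := interior_subset ht
    rw [(hd t ht').deriv]
    obtain ⟨⟨h1, h2⟩, -⟩ := hT t ht'
    exact mul_nonpos_of_nonneg_of_nonpos (pow_nonneg h1.le _) h2.le
  have hle : (γ T).2 ≤ 0 := ge_of_tendsto hy (by
    filter_upwards [eventually_le_atBot T] with t ht using hanti ht Set.self_mem_Iic ht)
  exact hle.not_gt (hT T le_rfl).1.1

theorem existsUnique_orbitsAlong (hk : k ≠ 0) (hP : P.IsHomogeneous (k + 1))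
    (hQ : Q.IsHomogeneous (k + 1)) (hP0 : eval ![0, 1] P = 0) (hQ0 : eval ![0, 1] Q < 0)
    (hslope : ∀ᶠ u in 𝓝 0, 0 ≤ u * slopeRate P Q u) :
    ∃! O : Set (ℝ × ℝ), O ∈ orbitsAlong P Q (Real.pi / 2) := by
  obtain ⟨y, hy, hypos, hylim, hysurj⟩ := exists_solution_axis hk hP hQ hP0 hQ0
  have hmem : ∀ s > 0, ∀ t > 0, ((0 : ℝ), y t) ∈ orbit P Q (0, y s) := fun s hs t ht =>
    mem_orbit_of_isSolutionOn hy isOpen_Ioi Set.ordConnected_Ioi hs ht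
  refine ⟨orbit P Q (0, y 1), ⟨⟨_, rfl⟩, fun t => (0, y t), Or.inl ⟨hy,
    fun t ht => hmem 1 one_pos t ht, ?_⟩⟩, ?_⟩
  · have := tendsToOriginAlong_pi_div_two (w := fun _ => 0) (l := atTop) tendsto_const_nhds hylim
      (by filter_upwards [eventually_gt_atTop 0] with t ht using hypos t ht)
    simpa only [zero_mul] using this
  · rintro O ⟨⟨p, rfl⟩, γ, ⟨hγ, hO, hlim⟩ | ⟨hγ, -, hlim⟩⟩
    · obtain ⟨t, ht, hx, hy0⟩ := exists_mem_axis_of_tendsto hP hQ hslope hγ hlim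
      obtain ⟨s, hs, hys⟩ := hysurj _ hy0
      have hγt : γ t = (0, y s) := Prod.ext hx hys.symm
      rw [← orbit_eq_of_mem (hO t ht), hγt, orbit_eq_of_mem (hmem 1 one_pos s hs)]
    · exact absurd hlim (not_tendsToOriginAlong_atBot hP hQ hQ0 hγ)

/-! ### The multiplicity of the direction -/

theorem iteratedDeriv_of_eventuallyEq_pow_mul {m : ℕ} {f F : ℝ → ℝ} {z : ℝ}
    (hF : AnalyticAt ℝ F z) (hf : ∀ᶠ s in 𝓝 z, f s = (s - z) ^ m * F s) :
    iteratedDeriv m f z = m.factorial * F z := by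
  induction m generalizing f F with
  | zero => simpa using hf.self_of_nhds
  | succ m ih =>
    have hd : ∀ᶠ s in 𝓝 z, deriv f s = (s - z) ^ m * ((m + 1) * F s + (s - z) * deriv F s) := by
      filter_upwards [hf.eventually_nhds, hF.eventually_analyticAt] with s hs hFs
      rw [EventuallyEq.deriv_eq hs]
      have h1 : HasDerivAt (fun r : ℝ => (r - z) ^ (m + 1)) ((m + 1 : ℕ) * (s - z) ^ m) s := by
        simpa using ((hasDerivAt_id s).sub_const z).fun_pow (m + 1)
      rw [(h1.fun_mul hFs.differentiableAt.hasDerivAt).deriv]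
      push_cast
      ring
    rw [iteratedDeriv_succ', ih (F := fun s => (m + 1) * F s + (s - z) * deriv F s) ?_ hd,
      Nat.factorial_succ]
    · push_cast
      ring
    · have := hF.deriv
      fun_prop

theorem analyticAt_Gtilde (P Q : MvPolynomial (Fin 2) ℝ) (θ : ℝ) :
    AnalyticAt ℝ (Gtilde P Q) θ :=
  analyticAt_eval_comp (G P Q) Real.analyticAt_cos Real.analyticAt_sin

theorem Gtilde_pi_div_two (P Q : MvPolynomial (Fin 2) ℝ) :
    Gtilde P Q (Real.pi / 2) = -eval ![0, 1] P := by
  simp [Gtilde, G]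

theorem Htilde_pi_div_two (P Q : MvPolynomial (Fin 2) ℝ) :
    Htilde P Q (Real.pi / 2) = eval ![0, 1] Q := by
  simp [Htilde, H]

theorem isHomogeneous_G {n : ℕ} (hP : P.IsHomogeneous n) (hQ : Q.IsHomogeneous n) :
    (G P Q).IsHomogeneous (1 + n) :=
  ((isHomogeneous_X ℝ 0).mul hQ).sub ((isHomogeneous_X ℝ 1).mul hP)

/-- The slope `u` corresponds to the angle `π / 2 - arctan u`. -/
theorem slopeRate_eq_Gtilde {n : ℕ} (hP : P.IsHomogeneous n) (hQ : Q.IsHomogeneous n) (u : ℝ) :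
    slopeRate P Q u = -(√(1 + u ^ 2) ^ (1 + n) * Gtilde P Q (Real.pi / 2 - Real.arctan u)) := by
  have h : √(1 + u ^ 2) ≠ 0 := (Real.sqrt_pos.mpr (by positivity)).ne'
  rw [slopeRate_eq_neg_eval_G, Gtilde, Real.cos_pi_div_two_sub, Real.sin_pi_div_two_sub,
    Real.sin_arctan, Real.cos_arctan, ← eval_smul_of_isHomogeneous (isHomogeneous_G hP hQ),
    mul_div_cancel₀ _ h, mul_div_cancel₀ _ h]

/-- The sign of the slope rate near `u = 0`, in terms of the leading coefficient `c` of `Gtilde` at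
`π / 2`. The power is one of `-u` because the angle `π / 2 - arctan u` decreases in the slope. -/
theorem exists_sign_slopeRate {n m : ℕ} (hP : P.IsHomogeneous n) (hQ : Q.IsHomogeneous n)
    (hm : analyticOrderAt (Gtilde P Q) (Real.pi / 2) = (m : ℕ∞)) :
    ∃ c : ℝ, iteratedDeriv m (Gtilde P Q) (Real.pi / 2) = m.factorial * c ∧
      ∀ᶠ u in 𝓝 0, u ≠ 0 → c * ((-u) ^ m * slopeRate P Q u) < 0 := by
  obtain ⟨F, hF, hF0, hGF⟩ := (analyticAt_Gtilde P Q _).analyticOrderAt_eq_natCast.mp hm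
  refine ⟨F (Real.pi / 2), iteratedDeriv_of_eventuallyEq_pow_mul hF hGF, ?_⟩
  have hang : Tendsto (fun u : ℝ => Real.pi / 2 - Real.arctan u) (𝓝 0) (𝓝 (Real.pi / 2)) := by
    have : Continuous fun u : ℝ => Real.pi / 2 - Real.arctan u := by fun_prop
    simpa using this.tendsto 0
  have hsign : ∀ᶠ θ in 𝓝 (Real.pi / 2), 0 < F (Real.pi / 2) * F θ :=
    continuousAt_const.eventually_lt (continuousAt_const.mul hF.continuousAt)
      (mul_self_pos.mpr hF0)
  filter_upwards [hang.eventually hGF, hang.eventually hsign] with u hu hs hne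
  rw [slopeRate_eq_Gtilde hP hQ, hu, smul_eq_mul]
  have hprod : 0 < (-u) ^ m * (-Real.arctan u) ^ m := by
    rw [← mul_pow]
    refine pow_pos ?_ m
    rw [neg_mul_neg]
    rcases hne.lt_or_gt with h | h
    · exact mul_pos_of_neg_of_neg h (Real.arctan_lt_zero.mpr h)
    · exact mul_pos h (Real.arctan_pos.mpr h)
  have hroot : 0 < √(1 + u ^ 2) ^ (1 + n) := pow_pos (Real.sqrt_pos.mpr (by positivity)) _
  have := mul_pos (mul_pos hroot hprod) hs
  calc _ = -(√(1 + u ^ 2) ^ (1 + n) * ((-u) ^ m * (-Real.arctan u) ^ m) *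
        (F (Real.pi / 2) * F (Real.pi / 2 - Real.arctan u))) := by
        rw [show Real.pi / 2 - Real.arctan u - Real.pi / 2 = -Real.arctan u by ring]
        ring
    _ < 0 := neg_neg_of_pos this

end HomogeneousPlanarSystem

/-! ### The three cases by parity and sign -/

namespace HomogeneousPlanarSystem

open MvPolynomial

variable {P Q : MvPolynomial (Fin 2) ℝ} {k m : ℕ} {c : ℝ}

theorem infinite_orbitsAlong_of_even (hP : P.IsHomogeneous (k + 1)) (hQ : Q.IsHomogeneous (k + 1))
    (hP0 : eval ![0, 1] P = 0) (hQ0 : eval ![0, 1] Q < 0) (hm : Even m)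
    (hc : ∀ᶠ u in 𝓝 0, u ≠ 0 → c * ((-u) ^ m * slopeRate P Q u) < 0) :
    (orbitsAlong P Q (Real.pi / 2)).Infinite := by
  have hprod : ∀ᶠ u in 𝓝 0, u ≠ 0 → c * slopeRate P Q u < 0 := hc.mono fun u hu hne => by
    have h1 := hu hne
    rw [mul_left_comm] at h1
    exact neg_of_mul_neg_right h1 (hm.pow_pos (neg_ne_zero.mpr hne)).le
  -- The slope rate has the same sign on both sides, so exactly one side is attracting.
  rcases le_or_gt 0 c with h | h
  · refine infinite_orbitsAlong_of_sector hP hQ hP0 hQ0 (one_mul 1) ?_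
    filter_upwards [hprod.filter_mono nhdsWithin_le_nhds, self_mem_nhdsWithin] with u hu hpos
    simpa only [one_mul] using neg_of_mul_neg_right (hu (ne_of_gt hpos)) h
  · refine infinite_orbitsAlong_of_sector hP hQ hP0 hQ0 (σ := -1) (by norm_num) ?_
    have hneg : Tendsto (fun u : ℝ => -u) (𝓝 0) (𝓝 0) := by
      simpa using (continuous_neg (G := ℝ)).tendsto 0
    filter_upwards [(hneg.eventually hprod).filter_mono nhdsWithin_le_nhds,
      self_mem_nhdsWithin] with u hu hpos
    have := hu (neg_ne_zero.mpr (ne_of_gt hpos))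
    simp only [neg_mul, one_mul]
    exact neg_neg_of_pos (pos_of_mul_neg_right this h.le)

theorem infinite_orbitsAlong_of_odd (hP : P.IsHomogeneous (k + 1)) (hQ : Q.IsHomogeneous (k + 1))
    (hP0 : eval ![0, 1] P = 0) (hQ0 : eval ![0, 1] Q < 0) (hm : Odd m) (hneg : c < 0)
    (hc : ∀ᶠ u in 𝓝 0, u ≠ 0 → c * ((-u) ^ m * slopeRate P Q u) < 0) :
    (orbitsAlong P Q (Real.pi / 2)).Infinite := by
  refine infinite_orbitsAlong_of_sector hP hQ hP0 hQ0 (one_mul 1) ?_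
  filter_upwards [hc.filter_mono nhdsWithin_le_nhds, self_mem_nhdsWithin] with u hu hpos
  have h1 := pos_of_mul_neg_right (hu (ne_of_gt hpos)) hneg.le
  rw [hm.neg_pow, neg_mul, neg_pos] at h1
  simpa only [one_mul] using neg_of_mul_neg_right h1 (pow_pos hpos m).le

theorem existsUnique_orbitsAlong_of_odd (hk : k ≠ 0) (hP : P.IsHomogeneous (k + 1))
    (hQ : Q.IsHomogeneous (k + 1)) (hP0 : eval ![0, 1] P = 0) (hQ0 : eval ![0, 1] Q < 0)
    (hm : Odd m) (hpos : 0 < c)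
    (hc : ∀ᶠ u in 𝓝 0, u ≠ 0 → c * ((-u) ^ m * slopeRate P Q u) < 0) :
    ∃! O : Set (ℝ × ℝ), O ∈ orbitsAlong P Q (Real.pi / 2) := by
  refine existsUnique_orbitsAlong hk hP hQ hP0 hQ0 (hc.mono fun u hu => ?_)
  rcases eq_or_ne u 0 with rfl | hne
  · simp
  have h1 := neg_of_mul_neg_right (hu hne) hpos.le
  rw [hm.neg_pow, neg_mul, neg_lt_zero] at h1
  rcases hne.lt_or_gt with h | h
  · exact (mul_pos_of_neg_of_neg h (neg_of_mul_pos_right h1 (hm.pow_neg h).le)).le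
  · exact (mul_pos h (pos_of_mul_pos_right h1 (pow_pos h m).le)).le

end HomogeneousPlanarSystem

open HomogeneousPlanarSystem MvPolynomial in
theorem mainTheorem8 (n : ℕ) (hn : 1 < n) (P Q : MvPolynomial (Fin 2) ℝ)
    (hP : P.IsHomogeneous n) (hQ : Q.IsHomogeneous n) (hPQ : IsRelPrime P Q)
    (m : ℕ)
    (hm : analyticOrderAt (HomogeneousPlanarSystem.Gtilde P Q) (Real.pi / 2) = (m : ℕ∞)) :
    (0 < m → Even m →
      (HomogeneousPlanarSystem.orbitsAlong P Q (Real.pi / 2)).Infinite) ∧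
    (Odd m →
      (0 < iteratedDeriv m (HomogeneousPlanarSystem.Gtilde P Q) (Real.pi / 2) *
            HomogeneousPlanarSystem.Htilde P Q (Real.pi / 2) →
        (HomogeneousPlanarSystem.orbitsAlong P Q (Real.pi / 2)).Infinite) ∧
      (iteratedDeriv m (HomogeneousPlanarSystem.Gtilde P Q) (Real.pi / 2) *
            HomogeneousPlanarSystem.Htilde P Q (Real.pi / 2) < 0 →
        ∃! O : Set (ℝ × ℝ), O ∈ HomogeneousPlanarSystem.orbitsAlong P Q (Real.pi / 2))) := by
  obtain ⟨k, rfl⟩ : ∃ k, n = k + 1 := ⟨n - 1, by omega⟩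
  have hk : k ≠ 0 := by omega
  obtain ⟨c, hder, hc⟩ := exists_sign_slopeRate hP hQ hm
  have hfact : (0 : ℝ) < m.factorial := Nat.cast_pos.mpr m.factorial_pos
  have hP0 : 0 < m → eval ![0, 1] P = 0 := fun hpos => by
    have hz : Gtilde P Q (Real.pi / 2) = 0 := by
      by_contra hne
      rw [(analyticAt_Gtilde P Q _).analyticOrderAt_eq_zero.mpr hne] at hm
      exact hpos.ne (by exact_mod_cast hm)
    rw [Gtilde_pi_div_two] at hz
    exact neg_eq_zero.mp hz
  -- The data of the system with time reversed.
  have hcn : ∀ᶠ u in 𝓝 0, u ≠ 0 → -c * ((-u) ^ m * slopeRate (-P) (-Q) u) < 0 :=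
    hc.mono fun u hu hne => by simpa only [slopeRate_neg, mul_neg, neg_mul, neg_neg] using hu hne
  have hP0n : 0 < m → eval ![0, 1] (-P) = 0 := fun hpos => by simp [hP0 hpos]
  have hQn : 0 < eval ![0, 1] Q → eval ![0, 1] (-Q) < 0 := fun h => by simpa using h
  rw [hder, Htilde_pi_div_two, mul_assoc]
  refine ⟨fun hpos heven => ?_, fun hodd => ⟨fun hprod => ?_, fun hprod => ?_⟩⟩
  · rcases (eval_ne_zero_of_isRelPrime hP hQ hPQ (hP0 hpos)).lt_or_gt with h | h
    · exact infinite_orbitsAlong_of_even hP hQ (hP0 hpos) h heven hc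
    · rw [← orbitsAlong_neg]
      exact infinite_orbitsAlong_of_even hP.neg hQ.neg (hP0n hpos) (hQn h) heven hcn
  · rcases mul_pos_iff.mp (pos_of_mul_pos_right hprod hfact.le) with ⟨h1, h2⟩ | ⟨h1, h2⟩
    · rw [← orbitsAlong_neg]
      exact infinite_orbitsAlong_of_odd hP.neg hQ.neg (hP0n hodd.pos) (hQn h2) hodd
        (neg_neg_of_pos h1) hcn
    · exact infinite_orbitsAlong_of_odd hP hQ (hP0 hodd.pos) h2 hodd h1 hc
  · rcases mul_neg_iff.mp (neg_of_mul_neg_right hprod hfact.le) with ⟨h1, h2⟩ | ⟨h1, h2⟩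
    · exact existsUnique_orbitsAlong_of_odd hk hP hQ (hP0 hodd.pos) h2 hodd h1 hc
    · rw [← orbitsAlong_neg]
      exact existsUnique_orbitsAlong_of_odd hk hP.neg hQ.neg (hP0n hodd.pos) (hQn h2) hodd
        (neg_pos.mpr h1) hcn
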